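/- A \emph{skew brace} is a set $A$ with two binary operations $+$ and $\circ$ such that $(A,+)$ and $(A,\circ)$ are groups (neither assumed abelian) and $a\circ(b+c)=a\circ b-a+a\circ c$ for all $a,b,c\in A$; it is \emph{two-sided} if moreover $(a+b)\circ c=a\circ c-c+b\circ c$ for all $a,b,c\in A$. For $a,b\in A$ put $a*b=-a+a\circ b-b$, and for subsets $X,Y\subseteq A$ let $X*Y$ be the subgroup of $(A,+)$ generated by all $x*y$ with $x\in X$, $y\in Y$. Put $A_1=A$ and $A_{n+1}=A_n*A_n$; the skew brace $A$ is \emph{soluble} if $A_n=\{0\}$ for some $n\geq 1$. A group satisfies the \emph{maximum condition on subgroups} if it has no infinite strictly ascending chain of subgroups. \textbf{Theorem.} Let $A$ be a two-sided skew brace such that at least one of the groups $(A,+)$ and $(A,\circ)$ satisfies the maximum condition on subgroups. Then $(A,+)$ is soluble if and only if $(A,\circ)$ is soluble. In this case, $A$ is a soluble skew brace. -/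

import Mathlib

/-- A skew (left) brace: a set with two group structures, the additive group `(A, +)` (not
necessarily commutative) and the multiplicative group `(A, ∘)`, where the operation `a ∘ b` is
written `a * b`, such that `a ∘ (b + c) = a ∘ b - a + a ∘ c`. -/
class SkewBrace (A : Type*) extends AddGroup A, Group A where
  mul_add_eq (a b c : A) : a * (b + c) = a * b - a + a * c

/-- A skew brace is two-sided if also `(a + b) ∘ c = a ∘ c - c + b ∘ c`. -/
class SkewBrace.IsTwoSided (A : Type*) [SkewBrace A] : Prop where
  add_mul_eq (a b c : A) : (a + b) * c = a * c - c + b * c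

/-- The operation usually written `a * b` in a skew brace, namely `-a + a ∘ b - b`. -/
def SkewBrace.star {A : Type*} [SkewBrace A] (a b : A) : A := -a + a * b - b

/-- For subsets `X`, `Y` of a skew brace, the additive subgroup generated by all the elements
`star x y` with `x ∈ X` and `y ∈ Y`. -/
def SkewBrace.starSubgroup {A : Type*} [SkewBrace A] (X Y : Set A) : AddSubgroup A :=
  AddSubgroup.closure {z | ∃ x ∈ X, ∃ y ∈ Y, SkewBrace.star x y = z}

/-- The derived series of a skew brace, indexed from `0`: it starts with the whole of `A`, and
each further term is the additive subgroup generated by the elements `star x y` with `x`, `y` in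
the term before. -/
def SkewBrace.derivedSeries (A : Type*) [SkewBrace A] : ℕ → AddSubgroup A
  | 0 => ⊤
  | n + 1 => SkewBrace.starSubgroup (SkewBrace.derivedSeries A n : Set A)
      (SkewBrace.derivedSeries A n : Set A)

/-- A skew brace is soluble if its derived series reaches `{0}`. -/
def SkewBrace.IsSoluble (A : Type*) [SkewBrace A] : Prop :=
  ∃ n : ℕ, SkewBrace.derivedSeries A n = ⊥

/-! Let S and O be the additive spans of all `star a b` and of all `opStar a b`. Modulo S the two
operations agree; modulo O they are opposite. Expanding (a + b) ∘ (c + d) in two ways shows that S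
and O commute elementwise, so R = S ∩ O is additively abelian and is a radical ring under `star`.
Both group structures on A are thus extensions of R by a subgroup of a product of A/S and A/O (or
its opposite), and solubility of either structure passes to both quotients.

What remains is that R is nilpotent. In the unitization U of R, the maximum condition makes U left
noetherian and makes the double centralizer of each x ∈ R a finitely generated commutative ring.
Such a ring is Jacobson, and x lies in its Jacobson radical, so x is nilpotent; Levitzki's theorem
then turns nil into nilpotent. Hence (R, ∘) ≅ 1 + R is soluble. Modulo O, `star` is a commutator, so
the brace series eventually enters R, where it descends through the powers of R. -/

/-! ### Nil elements and nil ideals -/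

/-- The ring of integers is a Jacobson ring. -/
theorem Int.isJacobsonRing : IsJacobsonRing ℤ := by
  rw [isJacobsonRing_iff_prime_eq]
  intro P hP
  by_cases h : P = ⊥
  · subst h
    refine le_antisymm (fun x hx => ?_) Ideal.le_jacobson
    have := Ideal.mem_jacobson_bot.1 hx x
    rw [Int.isUnit_iff] at this
    rw [Ideal.mem_bot]
    exact mul_self_eq_zero.1 (by have := mul_self_nonneg x; omega)
  · have := hP.isMaximal h
    exact Ideal.jacobson_eq_self_of_isMaximal

/-- In a finitely generated commutative ring, the Jacobson radical is nil. -/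
theorem isNilpotent_of_forall_isUnit_mul_add_one {S : Type*} [CommRing S] [Algebra.FiniteType ℤ S]
    {x : S} (hx : ∀ y, IsUnit (x * y + 1)) : IsNilpotent x := by
  have := Int.isJacobsonRing
  have : IsJacobsonRing S := isJacobsonRing_of_finiteType (A := ℤ)
  have h : x ∈ (⊥ : Ideal S).radical := by
    rw [Ideal.radical_eq_jacobson]
    exact Ideal.mem_jacobson_bot.2 hx
  simpa [Ideal.mem_radical_iff, IsNilpotent] using h

/-- Levitzki's theorem: in a left noetherian ring every nil two-sided ideal is nilpotent. -/
theorem Ideal.exists_pow_eq_bot_of_nil {U : Type*} [Ring U] [IsNoetherianRing U] (K : Ideal U)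
    [K.IsTwoSided] (hK : ∀ x ∈ K, IsNilpotent x) : ∃ n : ℕ, K ^ n = ⊥ := by
  -- N is a maximal nilpotent two-sided ideal; if K is not inside N, a strictly larger one will be
  -- built.
  obtain ⟨N, ⟨hN, m, hm⟩, hmax⟩ := WellFounded.has_min (wellFounded_gt (α := Ideal U))
    {N | N.IsTwoSided ∧ ∃ n : ℕ, N ^ n = ⊥} ⟨⊥, inferInstance, 1, by simp [Submodule.pow_one]⟩
  by_cases hKN : K ≤ N
  · exact ⟨m, le_bot_iff.1 (hm ▸ Ideal.pow_right_mono hKN m)⟩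
  exfalso
  let l : U → Ideal U := fun a => Submodule.comap (LinearMap.toSpanSingleton U U a) N
  have mem_l {x a : U} : x ∈ l a ↔ x * a ∈ N := Iff.rfl
  -- Among elements of K outside N, a has a maximal left annihilator modulo N.
  obtain ⟨_, ⟨a, ⟨haK, haN⟩, rfl⟩, ha⟩ := WellFounded.has_min (wellFounded_gt (α := Ideal U))
    (l '' {a | a ∈ K ∧ a ∉ N}) (by
      obtain ⟨a, h⟩ := SetLike.not_le_iff_exists.1 hKN
      exact ⟨_, a, h, rfl⟩)
  have key (x : U) : a * x * a ∈ N := by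
    by_cases hax : a * x ∈ N
    · exact N.mul_mem_right _ hax
    obtain ⟨k, hk⟩ := hK (a * x) (K.mul_mem_right _ haK)
    have hex : ∃ k, (a * x) ^ k ∈ N := ⟨k, hk ▸ N.zero_mem⟩
    classical
    obtain ⟨j, hj⟩ : ∃ j, Nat.find hex = j + 2 := by
      refine ⟨Nat.find hex - 2, ?_⟩
      have h0 : Nat.find hex ≠ 0 := fun h => by
        have := Nat.find_spec hex
        rw [h, pow_zero] at this
        exact haN (by simpa using N.mul_mem_left a this)
      have h1 : Nat.find hex ≠ 1 := fun h => by
        have := Nat.find_spec hex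
        rw [h, pow_one] at this
        exact hax this
      omega
    have hlast : (a * x) ^ (j + 1) ∉ N := Nat.find_min hex (by omega)
    have hmem : a * x * (a * x) ^ (j + 1) ∈ N := by
      rw [← pow_succ', ← hj]
      exact Nat.find_spec hex
    -- The last power of ax outside N has the same annihilator as a, by maximality; ax annihilates
    -- it, hence also a.
    have hle : l a ≤ l ((a * x) ^ (j + 1)) := fun y hy => by
      rw [mem_l, pow_succ', ← mul_assoc, ← mul_assoc]
      exact N.mul_mem_right _ (N.mul_mem_right _ hy)
    have heq : l a = l ((a * x) ^ (j + 1)) := by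
      by_contra hne
      refine ha _ ⟨_, ⟨?_, hlast⟩, rfl⟩ (lt_of_le_of_ne hle hne)
      rw [pow_succ', mul_assoc]
      exact K.mul_mem_right _ haK
    rw [← mem_l, heq]
    exact hmem
  -- M = N + UaU; since aUa ⊆ N, M² ⊆ N, so M is nilpotent and contradicts the choice of N.
  let M : Ideal U := N ⊔ Ideal.span {z | ∃ u, a * u = z}
  have hM : M.IsTwoSided := by
    refine ⟨fun {x} y hx => ?_⟩
    obtain ⟨p, hp, q, hq, rfl⟩ := Submodule.mem_sup.1 hx
    rw [add_mul]
    refine Submodule.add_mem_sup (N.mul_mem_right _ hp) ?_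
    clear hx
    induction hq using Submodule.span_induction with
    | mem q hq =>
      obtain ⟨u, rfl⟩ := hq
      exact Ideal.subset_span ⟨u * y, (mul_assoc _ _ _).symm⟩
    | zero => simp
    | add q r _ _ hq hr => rw [add_mul]; exact add_mem hq hr
    | smul c q _ hq => rw [smul_mul_assoc]; exact Submodule.smul_mem _ _ hq
  have hMa {r : U} (hr : r ∈ M) : ∀ u, r * u * a ∈ N := by
    have hle : M ≤ { carrier := {r | ∀ u, r * u * a ∈ N}
                     add_mem' := fun h h' u => by
                      rw [add_mul, add_mul]
                      exact add_mem (h u) (h' u)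
                     zero_mem' := fun u => by simp
                     smul_mem' := fun c r h u => by
                      rw [smul_mul_assoc, smul_mul_assoc]
                      exact N.smul_mem c (h u) } := by
      refine sup_le (fun r hr u => N.mul_mem_right _ (N.mul_mem_right _ hr)) (Ideal.span_le.2 ?_)
      rintro _ ⟨v, rfl⟩ u
      rw [mul_assoc a]
      exact key _
    exact hle hr
  have hMM : M * M ≤ N := by
    refine Ideal.mul_le.2 fun r hr s hs => ?_
    obtain ⟨p, hp, q, hq, rfl⟩ := Submodule.mem_sup.1 hs
    rw [mul_add]
    refine add_mem (N.mul_mem_left _ hp) ?_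
    clear hs
    induction hq using Submodule.span_induction generalizing r with
    | mem q hq =>
      obtain ⟨v, rfl⟩ := hq
      rw [← mul_assoc]
      exact N.mul_mem_right _ (by simpa using hMa hr 1)
    | zero => simp
    | add q s _ _ hq hs => rw [mul_add]; exact add_mem (hq r hr) (hs r hr)
    | smul c q _ hq =>
      rw [smul_eq_mul, ← mul_assoc]
      exact hq _ (M.mul_mem_right _ hr)
  have hpow (k : ℕ) : M ^ (2 * k) ≤ N ^ k := by
    induction k with
    | zero => simp [Submodule.pow_zero]
    | succ k ih =>
      rw [Nat.mul_succ, Ideal.IsTwoSided.pow_add, Submodule.pow_succ]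
      refine Ideal.mul_mono ih ?_
      rwa [Submodule.pow_succ, Submodule.pow_zero, Ideal.one_eq_top, Ideal.top_mul]
  refine hmax M ⟨hM, 2 * m, le_bot_iff.1 (hm ▸ hpow m)⟩ (lt_of_le_of_ne le_sup_left fun h => haN ?_)
  rw [h]
  exact Submodule.mem_sup_right (Ideal.subset_span ⟨1, mul_one a⟩)

/-! ### Groups of the form 1 + K, and finite generation -/

/-- The elements `g` with `f g ∈ 1 + L`, for a left ideal `L`. -/
def Ideal.oneAddSubgroup {U G : Type*} [Ring U] [Group G] (f : G →* U) (L : Ideal U) :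
    Subgroup G where
  carrier := {g | f g - 1 ∈ L}
  one_mem' := by simp
  mul_mem' := fun {g h} hg hh => by
    have : f (g * h) - 1 = f g * (f h - 1) + (f g - 1) := by rw [map_mul]; noncomm_ring
    rw [Set.mem_ofPred_eq, this]
    exact add_mem (L.mul_mem_left _ hh) hg
  inv_mem' := fun {g} hg => by
    have : f g⁻¹ - 1 = -(f g⁻¹ * (f g - 1)) := by
      rw [mul_sub, ← map_mul, inv_mul_cancel, map_one, mul_one, neg_sub]
    rw [Set.mem_ofPred_eq, this]
    exact neg_mem (L.mul_mem_left _ hg)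

open scoped commutatorElement in
/-- The group `1 + K` is solvable when `K` is a nilpotent two-sided ideal. -/
theorem Ideal.isSolvable_of_sub_one_mem {U G : Type*} [Ring U] [Group G] (K : Ideal U)
    [K.IsTwoSided] {n : ℕ} (hK : K ^ n = ⊥) (f : G →* U) (hf : Function.Injective f)
    (hfK : ∀ g, f g - 1 ∈ K) : Group.IsSolvable G := by
  have key (k : ℕ) : ∀ g ∈ derivedSeries G k, f g - 1 ∈ K ^ (k + 1) := by
    induction k with
    | zero => simpa [Submodule.pow_one] using hfK
    | succ k ih =>
      suffices derivedSeries G (k + 1) ≤ Ideal.oneAddSubgroup f (K ^ (k + 2)) from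
        fun g hg => this hg
      refine Subgroup.commutator_le.2 fun g hg h hh => ?_
      have hmul {x y : G} (hx : f x - 1 ∈ K ^ (k + 1)) (hy : f y - 1 ∈ K ^ (k + 1)) :
          (f x - 1) * (f y - 1) ∈ K ^ (k + 2) := by
        rw [Submodule.pow_succ (n := k + 1)]
        refine Ideal.mul_mem_mul hx (hfK y)
      -- From gh - hg = (g - 1)(h - 1) - (h - 1)(g - 1), multiplied on the right by (hg)⁻¹.
      have : f ⁅g, h⁆ - 1 = ((f g - 1) * (f h - 1) - (f h - 1) * (f g - 1)) * f (h * g)⁻¹ := by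
        have h1 : (f g - 1) * (f h - 1) - (f h - 1) * (f g - 1) = f (g * h) - f (h * g) := by
          rw [map_mul, map_mul]; noncomm_ring
        rw [h1, sub_mul, ← map_mul, ← map_mul, mul_inv_cancel, map_one, commutatorElement_def]
        congr 2
        group
      change f ⁅g, h⁆ - 1 ∈ K ^ (k + 2)
      rw [this]
      exact Ideal.mul_mem_right _ _ (sub_mem (hmul (ih g hg) (ih h hh)) (hmul (ih h hh) (ih g hg)))
  refine ⟨n, (Subgroup.eq_bot_iff_forall _).2 fun g hg => hf ?_⟩
  have := key n g hg
  rw [Submodule.pow_succ, hK] at this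
  have : f g - 1 ∈ (⊥ : Ideal U) := Ideal.mul_le.2 (fun r hr s _ => by simp_all) this
  rwa [Ideal.mem_bot, sub_eq_zero, ← map_one f] at this

/-- A group with the maximum condition on subgroups has finitely generated subgroups. -/
theorem Subgroup.fg_of_wellFoundedGT {G : Type*} [Group G] [WellFoundedGT (Subgroup G)]
    (H : Subgroup G) : H.FG := by
  obtain ⟨L, ⟨hLH, hL⟩, hmax⟩ := WellFounded.has_min (wellFounded_gt (α := Subgroup G))
    {L | L ≤ H ∧ L.FG} ⟨⊥, bot_le, ∅, by simp⟩
  obtain rfl | hlt := hLH.eq_or_lt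
  · exact hL
  obtain ⟨x, hxH, hxL⟩ := SetLike.exists_of_lt hlt
  refine absurd (left_lt_sup.2 fun h : Subgroup.zpowers x ≤ L => hxL (h (Subgroup.mem_zpowers x)))
    (hmax _ ⟨?_, ?_⟩)
  · exact sup_le hLH ((Subgroup.zpowers_le).2 hxH)
  · refine hL.sup ⟨{x}, ?_⟩
    rw [Finset.coe_singleton, Subgroup.zpowers_eq_closure]

/-- The double centralizer of an element is a commutative ring. If it is finitely generated and
`x` is in its Jacobson radical, then `x` is nilpotent. -/
theorem isNilpotent_of_fg_centralizer_centralizer {U : Type*} [Ring U] {x : U}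
    {S : Subalgebra ℤ U} (hS : S = Subalgebra.centralizer ℤ (Subalgebra.centralizer ℤ {x} : Set U))
    (hfg : S.FG) (hx : ∀ y ∈ S, IsUnit (x * y + 1)) : IsNilpotent x := by
  have hxS : x ∈ S := by
    rw [hS, Subalgebra.mem_centralizer_iff]
    intro g hg
    exact (Subalgebra.mem_centralizer_iff ℤ |>.1 hg x rfl).symm
  -- Since x centralizes itself, S lies in the centralizer of x, with which S commutes.
  have hcomm {y z : U} (hy : y ∈ S) (hz : z ∈ S) : y * z = z * y := by
    rw [hS, Subalgebra.mem_centralizer_iff] at hz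
    refine hz y ?_
    rw [SetLike.mem_coe, Subalgebra.mem_centralizer_iff]
    rintro _ rfl
    rw [hS, Subalgebra.mem_centralizer_iff] at hy
    refine hy _ ?_
    rw [SetLike.mem_coe, Subalgebra.mem_centralizer_iff]
    rintro _ rfl
    rfl
  let : CommRing S := { S.toRing with mul_comm := fun y z => Subtype.ext (hcomm y.2 z.2) }
  have : Algebra.FiniteType ℤ S := S.fg_iff_finiteType.1 hfg
  have hnil : IsNilpotent (⟨x, hxS⟩ : S) := by
    refine isNilpotent_of_forall_isUnit_mul_add_one fun y => ?_
    obtain ⟨u, hu⟩ := hx y y.2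
    have hinv : (↑u⁻¹ : U) ∈ S := by
      rw [hS, Subalgebra.mem_centralizer_iff]
      have h : (u : U) ∈ S := hu ▸ add_mem (mul_mem hxS y.2) (one_mem _)
      rw [hS, Subalgebra.mem_centralizer_iff] at h
      exact fun g hg => (Commute.units_inv_right (h g hg)).eq
    refine IsUnit.of_mul_eq_one ⟨↑u⁻¹, hinv⟩ (Subtype.ext ?_)
    change (x * (y : U) + 1) * ↑u⁻¹ = 1
    rw [← hu, Units.mul_inv]
  obtain ⟨n, hn⟩ := hnil
  exact ⟨n, congrArg Subtype.val hn⟩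

/-! ### Nilpotency from the maximum condition -/

section Adjoint

variable {U G : Type*} [Ring U] [Group G] (K : Ideal U) (f : G →* U)

/-- As 1 + K is covered by f, the map L ↦ f⁻¹(1 + L) embeds the left ideals inside K into the
subgroups of G. -/
theorem Ideal.wellFoundedGT_submodule (hK : ∀ x ∈ K, ∃ g, f g = 1 + x)
    (h : WellFoundedGT (AddSubgroup K) ∨ WellFoundedGT (Subgroup G)) :
    WellFoundedGT (Submodule U K) := by
  obtain h | h := h
  · exact StrictMono.wellFoundedGT (f := Submodule.toAddSubgroup)
      (Submodule.toAddSubgroup_strictMono)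
  · refine StrictMono.wellFoundedGT
      (f := fun L : Submodule U K => Ideal.oneAddSubgroup f (L.map K.subtype)) ?_
    refine Monotone.strictMono_of_injective ?_ ?_
    · intro L M hLM g hg
      exact Submodule.map_mono hLM hg
    · have key {L M : Submodule U K} (hLM : Ideal.oneAddSubgroup f (L.map K.subtype) ≤
          Ideal.oneAddSubgroup f (M.map K.subtype)) : L ≤ M := by
        intro x hx
        obtain ⟨g, hg⟩ := hK x x.2
        have : f g - 1 ∈ M.map K.subtype := hLM (show f g - 1 ∈ L.map K.subtype from
          ⟨x, hx, by simp [hg]⟩)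
        obtain ⟨y, hy, hxy⟩ := this
        rw [hg, add_sub_cancel_left] at hxy
        rwa [← Subtype.ext hxy]
      intro L M hLM
      exact le_antisymm (key hLM.le) (key hLM.ge)

variable {K f}

/-- Let `U` be generated additively by `1` and a two-sided ideal `K` such that `1 + K` is a group
of units. If the additive group `K` or the group `1 + K` satisfies the maximum condition on
subgroups, then `K` is nilpotent. -/
theorem Ideal.exists_pow_eq_bot_of_wellFoundedGT [K.IsTwoSided]
    (hU : ∀ u : U, ∃ n : ℤ, u - n ∈ K)
    (hK : ∀ x ∈ K, ∃ g, f g = 1 + x)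
    (h : WellFoundedGT (AddSubgroup K) ∨ WellFoundedGT (Subgroup G)) : ∃ n : ℕ, K ^ n = ⊥ := by
  have hquot : IsNoetherian ℤ (U ⧸ K) := by
    refine isNoetherian_of_surjective (LinearMap.toSpanSingleton ℤ (U ⧸ K) (Submodule.Quotient.mk 1))
      (LinearMap.range_eq_top.2 fun y => ?_)
    obtain ⟨u, rfl⟩ := Submodule.Quotient.mk_surjective K y
    obtain ⟨n, hn⟩ := hU u
    refine ⟨n, ?_⟩
    rw [LinearMap.toSpanSingleton_apply, ← Submodule.Quotient.mk_smul, eq_comm,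
      Submodule.Quotient.eq]
    simpa using hn
  have : IsNoetherianRing U := by
    refine (isNoetherian_iff_submodule_quotient K).2 ⟨?_, isNoetherian_of_tower ℤ hquot⟩
    exact isNoetherian_iff'.2 (Ideal.wellFoundedGT_submodule K f hK h)
  refine Ideal.exists_pow_eq_bot_of_nil K fun x hx => ?_
  refine isNilpotent_of_fg_centralizer_centralizer rfl ?_ fun y _ => ?_
  · set S := Subalgebra.centralizer ℤ (Subalgebra.centralizer ℤ {x} : Set U)
    obtain h | h := h
    · have : IsNoetherian ℤ (K.restrictScalars ℤ) := by
        refine isNoetherian_iff'.2 ?_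
        exact StrictMono.wellFoundedGT (α := Submodule ℤ K) (f := Submodule.toAddSubgroup)
          (Submodule.toAddSubgroup_strictMono)
      have : IsNoetherian ℤ U :=
        (isNoetherian_iff_submodule_quotient (K.restrictScalars ℤ)).2 ⟨this, hquot⟩
      exact Subalgebra.fg_of_fg_toSubmodule (IsNoetherian.noetherian _)
    -- S is generated as a ring by its units in 1 + K, because s = (1 + (s - n)) - 1 + n. They come
    -- from a subgroup, as centralizers are closed under inverses.
    · let H : Subgroup G :=
        { S.toSubmonoid.comap f with
          inv_mem' := fun {g} hg => by
            change f g⁻¹ ∈ S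
            have hg : f g ∈ S := hg
            rw [Subalgebra.mem_centralizer_iff] at hg ⊢
            intro c hc
            calc c * f g⁻¹ = f g⁻¹ * (f g * c) * f g⁻¹ := by
                  rw [← mul_assoc, ← map_mul, inv_mul_cancel, map_one, one_mul]
              _ = f g⁻¹ * c := by
                  rw [← hg c hc, mul_assoc, mul_assoc, ← map_mul, mul_inv_cancel, map_one,
                    mul_one] }
      obtain ⟨T, hT⟩ := Subgroup.fg_of_wellFoundedGT H
      classical
      refine ⟨T.image f ∪ T.image fun g => f g⁻¹, le_antisymm (Algebra.adjoin_le ?_) ?_⟩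
      · have hTH {g : G} (hg : g ∈ T) : g ∈ H := hT ▸ Subgroup.subset_closure hg
        simp only [Finset.coe_union, Finset.coe_image, Set.union_subset_iff, Set.image_subset_iff]
        exact ⟨fun g hg => hTH hg, fun g hg => H.inv_mem (hTH hg)⟩
      · intro s hs
        obtain ⟨n, hn⟩ := hU s
        obtain ⟨g, hg⟩ := hK _ hn
        have hgH : g ∈ H := by
          change f g ∈ S
          rw [hg]
          exact add_mem (one_mem _) (sub_mem hs (intCast_mem _ n))
        have hs : s = f g - 1 + n := by rw [hg]; abel
        rw [hs]
        refine add_mem (sub_mem ?_ (one_mem _)) (intCast_mem _ n)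
        rw [← hT] at hgH
        clear hs hg
        induction hgH using Subgroup.closure_induction'' with
        | mem g hg =>
          exact Algebra.subset_adjoin (by simpa using Or.inl ⟨g, hg, rfl⟩)
        | inv_mem g hg =>
          exact Algebra.subset_adjoin (by simpa using Or.inr ⟨g, hg, rfl⟩)
        | one => rw [map_one]; exact one_mem _
        | mul g h _ _ hg hh => rw [map_mul]; exact mul_mem hg hh
  · obtain ⟨g, hg⟩ := hK _ (K.mul_mem_right y hx)
    rw [add_comm, ← hg]
    exact (Group.isUnit g).map f

end Adjoint

/-! ### The two quotients of a two-sided skew brace -/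

namespace SkewBrace

variable {A : Type*} [SkewBrace A]

theorem one_eq_zero : (1 : A) = 0 := by
  have h := mul_add_eq (1 : A) 0 0
  simpa using h

/-- The operation `star` of the opposite skew brace, up to the order of summands. -/
def opStar (a b : A) : A := -b + a * b - a

variable (A) in
/-- The additive subgroup generated by all `star a b`. -/
def starSpan : AddSubgroup A := AddSubgroup.closure {z | ∃ a b : A, star a b = z}

variable (A) in
/-- The additive subgroup generated by all `opStar a b`. -/
def opStarSpan : AddSubgroup A := AddSubgroup.closure {z | ∃ a b : A, opStar a b = z}

theorem star_mem_starSpan (a b : A) : star a b ∈ starSpan A :=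
  AddSubgroup.subset_closure ⟨a, b, rfl⟩

theorem opStar_mem_opStarSpan (a b : A) : opStar a b ∈ opStarSpan A :=
  AddSubgroup.subset_closure ⟨a, b, rfl⟩

theorem star_add (a b c : A) : star a (b + c) = star a b + (b + star a c - b) := by
  simp only [star, mul_add_eq, sub_eq_add_neg, neg_add_rev, add_assoc, neg_add_cancel_left]

/-- By `star_add`, a conjugate of `star a c` by b is -`star a b` + `star a (b + c)`. -/
instance : (starSpan A).Normal := by
  refine ⟨fun x hx b => ?_⟩
  induction hx using AddSubgroup.closure_induction with
  | mem x hx =>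
    obtain ⟨a, c, rfl⟩ := hx
    have h : b + star a c + -b = -star a b + star a (b + c) := by
      rw [star_add, neg_add_cancel_left, sub_eq_add_neg]
    rw [h]
    exact add_mem (neg_mem (star_mem_starSpan a b)) (star_mem_starSpan a (b + c))
  | zero => simp
  | add x y _ _ hx hy =>
    have h : b + (x + y) + -b = (b + x + -b) + (b + y + -b) := by
      simp only [add_assoc, neg_add_cancel_left]
    rw [h]
    exact add_mem hx hy
  | neg x _ hx =>
    have h : b + -x + -b = -(b + x + -b) := by simp only [neg_add_rev, neg_neg, add_assoc]
    rw [h]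
    exact neg_mem hx

/-- Modulo `starSpan A`, the two operations coincide. -/
def toQuotStar : A →* Multiplicative (A ⧸ starSpan A) :=
  MonoidHom.mk' (fun a => Multiplicative.ofAdd (QuotientAddGroup.mk a)) fun a b => by
    rw [← ofAdd_add, ← QuotientAddGroup.mk_add]
    refine congrArg Multiplicative.ofAdd (Eq.symm (QuotientAddGroup.eq.2 ?_))
    have h : -(a + b) + a * b = -b + star a b + - -b := by
      simp only [star, sub_eq_add_neg, neg_add_rev, add_assoc, neg_neg, neg_add_cancel, add_zero]
    rw [h]
    exact AddSubgroup.Normal.conj_mem inferInstance _ (star_mem_starSpan a b) _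

theorem mem_ker_toQuotStar {a : A} : a ∈ (toQuotStar (A := A)).ker ↔ a ∈ starSpan A :=
  QuotientAddGroup.eq_zero_iff a

variable [IsTwoSided A]

theorem add_opStar (a b c : A) : opStar (a + b) c = opStar a c + (a + opStar b c - a) := by
  simp only [opStar, IsTwoSided.add_mul_eq, sub_eq_add_neg, neg_add_rev, add_assoc,
    neg_add_cancel_left]

instance : (opStarSpan A).Normal := by
  refine ⟨fun x hx a => ?_⟩
  induction hx using AddSubgroup.closure_induction with
  | mem x hx =>
    obtain ⟨b, c, rfl⟩ := hx
    have h : a + opStar b c + -a = -opStar a c + opStar (a + b) c := by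
      rw [add_opStar, neg_add_cancel_left, sub_eq_add_neg]
    rw [h]
    exact add_mem (neg_mem (opStar_mem_opStarSpan a c)) (opStar_mem_opStarSpan (a + b) c)
  | zero => simp
  | add x y _ _ hx hy =>
    have h : a + (x + y) + -a = (a + x + -a) + (a + y + -a) := by
      simp only [add_assoc, neg_add_cancel_left]
    rw [h]
    exact add_mem hx hy
  | neg x _ hx =>
    have h : a + -x + -a = -(a + x + -a) := by simp only [neg_add_rev, neg_neg, add_assoc]
    rw [h]
    exact neg_mem hx

/-- Modulo `opStarSpan A`, the two operations are opposite to each other. -/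
def toQuotOpStar : A →* (Multiplicative (A ⧸ opStarSpan A))ᵐᵒᵖ :=
  MonoidHom.mk' (fun a => MulOpposite.op (Multiplicative.ofAdd (QuotientAddGroup.mk a)))
    fun a b => by
      rw [← MulOpposite.op_mul, ← ofAdd_add, ← QuotientAddGroup.mk_add]
      refine congrArg (MulOpposite.op ∘ Multiplicative.ofAdd) (Eq.symm (QuotientAddGroup.eq.2 ?_))
      have h : -(b + a) + a * b = -a + opStar a b + - -a := by
        simp only [opStar, sub_eq_add_neg, neg_add_rev, add_assoc, neg_neg, neg_add_cancel, add_zero]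
      rw [h]
      exact AddSubgroup.Normal.conj_mem inferInstance _ (opStar_mem_opStarSpan a b) _

theorem mem_ker_toQuotOpStar {a : A} : a ∈ (toQuotOpStar (A := A)).ker ↔ a ∈ opStarSpan A := by
  rw [MonoidHom.mem_ker, ← MulOpposite.op_one, ← QuotientAddGroup.eq_zero_iff a]
  exact MulOpposite.op_injective.eq_iff

/-- Expanding `(a + b) * (c + d)` in two ways. -/
theorem star_add_opStar (a b c d : A) : star a d + opStar b c = opStar b c + star a d := by
  have h1 : (a + b) * (c + d) = a * c - c + b * c + (-b + -a + (a * d + (-d + b * d))) := by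
    rw [mul_add_eq, IsTwoSided.add_mul_eq, IsTwoSided.add_mul_eq a b d]
    simp only [sub_eq_add_neg, neg_add_rev, add_assoc]
  have h2 : (a + b) * (c + d) = a * c - a + a * d + (-d + -c + (b * c + (-b + b * d))) := by
    rw [IsTwoSided.add_mul_eq, mul_add_eq, mul_add_eq b c d]
    simp only [sub_eq_add_neg, neg_add_rev, add_assoc]
  have h := h1.symm.trans h2
  simp only [sub_eq_add_neg, add_assoc, add_right_inj] at h
  -- Once a ∘ c is cancelled on the left, b ∘ d is isolated for cancellation on the right.
  have h3 : -c + (b * c + (-b + (-a + (a * d + -d)))) + b * d =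
      -a + (a * d + (-d + (-c + (b * c + -b)))) + b * d := by
    simpa only [add_assoc] using h
  simpa only [star, opStar, sub_eq_add_neg, add_assoc] using (add_right_cancel h3).symm

theorem add_comm_of_mem {x y : A} (hx : x ∈ starSpan A) (hy : y ∈ opStarSpan A) :
    x + y = y + x := by
  change AddCommute x y
  induction hx using AddSubgroup.closure_induction with
  | mem x hx =>
    obtain ⟨a, d, rfl⟩ := hx
    induction hy using AddSubgroup.closure_induction with
    | mem y hy =>
      obtain ⟨b, c, rfl⟩ := hy
      exact star_add_opStar a b c d
    | zero => exact AddCommute.zero_right _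
    | add y z _ _ h h' => exact h.add_right h'
    | neg y _ h => exact h.neg_right
  | zero => exact AddCommute.zero_left _
  | add x z _ _ h h' => exact h.add_left h'
  | neg x _ h => exact h.neg_left

/-! ### The radical ring and its unitization -/

variable (A) in
/-- The intersection of `starSpan A` and `opStarSpan A`, as an additive subgroup. -/
def radicalPart : AddSubgroup A := starSpan A ⊓ opStarSpan A

variable (A) in
/-- The intersection of `starSpan A` and `opStarSpan A`, as a multiplicative subgroup. -/
def mulRadicalPart : Subgroup A := (toQuotStar (A := A)).ker ⊓ (toQuotOpStar (A := A)).ker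

theorem mem_mulRadicalPart {a : A} : a ∈ mulRadicalPart A ↔ a ∈ radicalPart A :=
  and_congr mem_ker_toQuotStar mem_ker_toQuotOpStar

theorem mul_mem_radicalPart {a b : A} (ha : a ∈ radicalPart A) (hb : b ∈ radicalPart A) :
    a * b ∈ radicalPart A :=
  mem_mulRadicalPart.1 (mul_mem (mem_mulRadicalPart.2 ha) (mem_mulRadicalPart.2 hb))

theorem star_mem_radicalPart {a b : A} (ha : a ∈ radicalPart A) (hb : b ∈ radicalPart A) :
    star a b ∈ radicalPart A :=
  sub_mem (add_mem (neg_mem ha) (mul_mem_radicalPart ha hb)) hb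

instance : AddCommGroup (radicalPart A) :=
  { (radicalPart A).toAddGroup with
    add_comm := fun x y => Subtype.ext (add_comm_of_mem x.2.1 y.2.2) }

instance : Mul (radicalPart A) := ⟨fun x y => ⟨star x.1 y.1, star_mem_radicalPart x.2 y.2⟩⟩

theorem coe_mul_radicalPart (x y : radicalPart A) : ((x * y : radicalPart A) : A) = star x.1 y.1 :=
  rfl

/-- The adjoint formula x ∘ y = x + y + xy, through which brace axioms become ring axioms. -/
theorem coe_mul_coe (x y : radicalPart A) : (x : A) * y = (x + y + x * y : radicalPart A) := by
  have h : x + y + x * y = x + x * y + y := by abel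
  rw [h]
  simp [coe_mul_radicalPart, star, sub_eq_add_neg, add_assoc]

protected theorem left_distrib (x y z : radicalPart A) : x * (y + z) = x * y + x * z := by
  have h : x * (y + z) = x * y + (y + x * z - y) := Subtype.ext (star_add x.1 y.1 z.1)
  rw [h, add_sub_cancel_left]

protected theorem right_distrib (x y z : radicalPart A) : (x + y) * z = x * z + y * z := by
  have h := IsTwoSided.add_mul_eq (x : A) y z
  rw [coe_mul_coe, coe_mul_coe, ← AddSubgroup.coe_add, coe_mul_coe, ← AddSubgroup.coe_sub,
    ← AddSubgroup.coe_add, Subtype.val_inj, ← sub_eq_zero] at h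
  rw [← sub_eq_zero, ← h]
  abel

/-- The radical ring structure on `radicalPart A`, with multiplication `star`. -/
instance : NonUnitalRing (radicalPart A) where
  left_distrib := SkewBrace.left_distrib
  right_distrib := SkewBrace.right_distrib
  zero_mul x := by simpa using SkewBrace.right_distrib 0 0 x
  mul_zero x := by simpa using SkewBrace.left_distrib x 0 0
  mul_assoc x y z := by
    have h := mul_assoc (x : A) y z
    rw [coe_mul_coe, coe_mul_coe, coe_mul_coe, coe_mul_coe, Subtype.val_inj,
      SkewBrace.left_distrib, SkewBrace.left_distrib, SkewBrace.right_distrib,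
      SkewBrace.right_distrib, ← sub_eq_zero] at h
    rw [← sub_eq_zero, ← h]
    abel

variable (A) in
/-- The unitization of the radical ring `radicalPart A`. -/
def RadicalUnitization : Type _ := Unitization ℤ (radicalPart A)

instance : Ring (RadicalUnitization A) := inferInstanceAs (Ring (Unitization ℤ (radicalPart A)))

variable (A) in
/-- The embedding of `radicalPart A` in its unitization. -/
def inr : radicalPart A →ₙ+* RadicalUnitization A where
  toFun x := (Unitization.inr x : Unitization ℤ (radicalPart A))
  map_zero' := Unitization.inr_zero ℤ
  map_add' := Unitization.inr_add ℤ
  map_mul' := Unitization.inr_mul ℤ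

theorem inr_injective : Function.Injective (inr A) := Unitization.inr_injective

variable (A) in
/-- The augmentation of the unitization of `radicalPart A`. -/
def augmentation : RadicalUnitization A →+* ℤ :=
  (Unitization.fstHom ℤ (radicalPart A)).toRingHom

variable (A) in
/-- `radicalPart A` as a two-sided ideal of its unitization. -/
def radicalIdeal : Ideal (RadicalUnitization A) := RingHom.ker (augmentation A)

instance : (radicalIdeal A).IsTwoSided := by unfold radicalIdeal; infer_instance

theorem inr_mem_radicalIdeal (x : radicalPart A) : inr A x ∈ radicalIdeal A :=
  Unitization.fst_inr ℤ x

theorem exists_inr_eq {u : RadicalUnitization A} (hu : u ∈ radicalIdeal A) : ∃ x, inr A x = u :=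
  ⟨(Unitization.toProd u).snd, Unitization.ext (Eq.symm hu) rfl⟩

theorem exists_sub_intCast_mem_radicalIdeal (u : RadicalUnitization A) :
    ∃ n : ℤ, u - n ∈ radicalIdeal A :=
  ⟨augmentation A u, by rw [radicalIdeal, RingHom.mem_ker, map_sub, map_intCast, Int.cast_id,
    sub_self]⟩

/-- An element of `mulRadicalPart A` as an element of `radicalPart A`. -/
def toRadicalPart (g : mulRadicalPart A) : radicalPart A := ⟨g, mem_mulRadicalPart.1 g.2⟩

variable (A) in
/-- The multiplicative group of `radicalPart A` is the group `1 + radicalIdeal A`. -/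
def oneAddInr : mulRadicalPart A →* RadicalUnitization A where
  toFun g := 1 + inr A (toRadicalPart g)
  map_one' := by
    have h : toRadicalPart (1 : mulRadicalPart A) = 0 := Subtype.ext one_eq_zero
    rw [h, map_zero, add_zero]
  map_mul' g h := by
    have hgh : toRadicalPart (g * h) =
        toRadicalPart g + toRadicalPart h + toRadicalPart g * toRadicalPart h :=
      Subtype.ext (coe_mul_coe (toRadicalPart g) (toRadicalPart h))
    rw [hgh, map_add, map_add, map_mul]
    noncomm_ring

theorem oneAddInr_injective : Function.Injective (oneAddInr A) := fun _ _ h =>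
  Subtype.ext (Subtype.mk.inj (inr_injective (add_left_cancel h)))

theorem oneAddInr_sub_one_mem (g : mulRadicalPart A) : oneAddInr A g - 1 ∈ radicalIdeal A := by
  have : oneAddInr A g - 1 = inr A (toRadicalPart g) := add_sub_cancel_left _ _
  rw [this]
  exact inr_mem_radicalIdeal _

theorem exists_radicalIdeal_pow_eq_bot
    (hmax : WellFoundedGT (AddSubgroup A) ∨ WellFoundedGT (Subgroup A)) :
    ∃ n : ℕ, radicalIdeal A ^ n = ⊥ := by
  refine Ideal.exists_pow_eq_bot_of_wellFoundedGT (f := oneAddInr A)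
    exists_sub_intCast_mem_radicalIdeal (fun u hu => ?_) (hmax.imp ?_ ?_)
  · obtain ⟨x, rfl⟩ := exists_inr_eq hu
    exact ⟨⟨x, mem_mulRadicalPart.2 x.2⟩, rfl⟩
  · intro _
    let f : radicalIdeal A →+ A :=
      { toFun := fun u => ((Unitization.toProd u.1).snd : radicalPart A)
        map_zero' := rfl
        map_add' := fun _ _ => rfl }
    have hf : Function.Injective f := by
      rintro ⟨u, hu⟩ ⟨v, hv⟩ huv
      exact Subtype.ext (Unitization.ext (Eq.trans hu (Eq.symm hv)) (Subtype.ext huv))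
    exact StrictMono.wellFoundedGT (f := AddSubgroup.map f)
      (Monotone.strictMono_of_injective (fun _ _ => AddSubgroup.map_mono)
        (AddSubgroup.map_injective hf))
  · intro _
    exact StrictMono.wellFoundedGT (f := Subgroup.map (mulRadicalPart A).subtype)
      (Monotone.strictMono_of_injective (fun _ _ => Subgroup.map_mono)
        (Subgroup.map_injective (Subgroup.subtype_injective _)))

/-! ### Transfer of solubility -/

theorem isSolvable_quotients_of_isSolvable_add (h : Group.IsSolvable (Multiplicative A)) :
    Group.IsSolvable (Multiplicative (A ⧸ starSpan A)) ∧
      Group.IsSolvable (Multiplicative (A ⧸ opStarSpan A)) :=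
  ⟨Group.isSolvable_of_surjective (G := Multiplicative A)
    (f := AddMonoidHom.toMultiplicative (QuotientAddGroup.mk' (starSpan A)))
    (QuotientAddGroup.mk'_surjective (starSpan A)),
    Group.isSolvable_of_surjective (G := Multiplicative A)
      (f := AddMonoidHom.toMultiplicative (QuotientAddGroup.mk' (opStarSpan A)))
      (QuotientAddGroup.mk'_surjective (opStarSpan A))⟩

theorem isSolvable_quotients_of_isSolvable_mul (h : Group.IsSolvable A) :
    Group.IsSolvable (Multiplicative (A ⧸ starSpan A)) ∧
      Group.IsSolvable (Multiplicative (A ⧸ opStarSpan A)) := by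
  refine ⟨Group.isSolvable_of_surjective (f := toQuotStar) (QuotientAddGroup.mk'_surjective _), ?_⟩
  have : Group.IsSolvable (Multiplicative (A ⧸ opStarSpan A))ᵐᵒᵖ :=
    Group.isSolvable_of_surjective (f := toQuotOpStar)
      (MulOpposite.op_surjective.comp (QuotientAddGroup.mk'_surjective _))
  exact Group.isSolvable_of_surjective
    -- Inversion identifies a group with its opposite.
    (f := (MulEquiv.inv' (Multiplicative (A ⧸ opStarSpan A))).symm.toMonoidHom)
    (MulEquiv.surjective _)

/-- The kernel of A → A/S × A/O is R, which is additively abelian; no nilpotency is needed. -/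
theorem isSolvable_add_of_quotients (h : Group.IsSolvable (Multiplicative (A ⧸ starSpan A)))
    (h' : Group.IsSolvable (Multiplicative (A ⧸ opStarSpan A))) :
    Group.IsSolvable (Multiplicative A) := by
  refine Group.isSolvable_of_ker_le_range
    (AddMonoidHom.toMultiplicative (radicalPart A).subtype)
    ((AddMonoidHom.toMultiplicative (QuotientAddGroup.mk' (starSpan A))).prod
      (AddMonoidHom.toMultiplicative (QuotientAddGroup.mk' (opStarSpan A)))) fun a ha => ?_
  obtain ⟨h1, h2⟩ := Prod.ext_iff.1 (MonoidHom.mem_ker.1 ha)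
  exact ⟨Multiplicative.ofAdd ⟨a.toAdd, (QuotientAddGroup.eq_zero_iff _).1 h1,
    (QuotientAddGroup.eq_zero_iff _).1 h2⟩, rfl⟩

theorem isSolvable_mul_of_quotients {n : ℕ} (hn : radicalIdeal A ^ n = ⊥)
    (h : Group.IsSolvable (Multiplicative (A ⧸ starSpan A)))
    (h' : Group.IsSolvable (Multiplicative (A ⧸ opStarSpan A))) : Group.IsSolvable A := by
  have : Group.IsSolvable (mulRadicalPart A) := Ideal.isSolvable_of_sub_one_mem (radicalIdeal A) hn
    (oneAddInr A) oneAddInr_injective oneAddInr_sub_one_mem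
  have : Group.IsSolvable (Multiplicative (A ⧸ opStarSpan A))ᵐᵒᵖ :=
    Group.isSolvable_of_surjective
      (f := (MulEquiv.inv' (Multiplicative (A ⧸ opStarSpan A))).toMonoidHom) (MulEquiv.surjective _)
  refine Group.isSolvable_of_ker_le_range (mulRadicalPart A).subtype
    ((toQuotStar (A := A)).prod toQuotOpStar) ?_
  rw [Subgroup.range_subtype, MonoidHom.ker_prod, mulRadicalPart]

-- Modulo O, x ∘ y = y + x, so `star x y` = -x + y + x - y, a commutator.
open scoped commutatorElement in
theorem mk_star_mem_derivedSeries (k : ℕ) {a : A} (ha : a ∈ derivedSeries A k) :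
    Multiplicative.ofAdd (a : A ⧸ opStarSpan A) ∈
      _root_.derivedSeries (Multiplicative (A ⧸ opStarSpan A)) k := by
  induction k generalizing a with
  | zero => trivial
  | succ k ih =>
    induction ha using AddSubgroup.closure_induction with
    | mem z hz =>
      obtain ⟨x, hx, y, hy, rfl⟩ := hz
      have hxy : ((x * y : A) : A ⧸ opStarSpan A) = (y : A ⧸ opStarSpan A) + x :=
        congrArg (fun u => u.unop.toAdd) (map_mul toQuotOpStar x y)
      have h : Multiplicative.ofAdd ((star x y : A) : A ⧸ opStarSpan A) =
          ⁅(Multiplicative.ofAdd (x : A ⧸ opStarSpan A))⁻¹,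
            Multiplicative.ofAdd (y : A ⧸ opStarSpan A)⁆ := by
        rw [star, sub_eq_add_neg, QuotientAddGroup.mk_add, QuotientAddGroup.mk_add, hxy,
          commutatorElement_def, inv_inv, ← add_assoc]
        rfl
      rw [h]
      exact Subgroup.commutator_mem_commutator (inv_mem (ih hx)) (ih hy)
    | zero => exact one_mem _
    | add x y _ _ hx hy => exact mul_mem hx hy
    | neg x _ hx => exact inv_mem hx

theorem isSoluble_of_isSolvable_quotient {n : ℕ} (hn : radicalIdeal A ^ n = ⊥)
    (h : Group.IsSolvable (Multiplicative (A ⧸ opStarSpan A))) : IsSoluble A := by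
  obtain ⟨m, hm⟩ := h.solvable
  have hop {k : ℕ} {a : A} (hk : m ≤ k) (ha : a ∈ derivedSeries A k) : a ∈ opStarSpan A := by
    have := _root_.derivedSeries_antitone _ hk (mk_star_mem_derivedSeries k ha)
    rw [hm, Subgroup.mem_bot] at this
    exact (QuotientAddGroup.eq_zero_iff a).1 this
  have hstar (k : ℕ) : derivedSeries A (k + 1) ≤ starSpan A :=
    AddSubgroup.closure_mono fun z ⟨x, _, y, _, hz⟩ => ⟨x, y, hz⟩
  have key (k : ℕ) : ∀ a ∈ derivedSeries A (m + 1 + k), ∃ x : radicalPart A, (x : A) = a ∧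
      inr A x ∈ radicalIdeal A ^ (k + 1) := by
    induction k with
    | zero =>
      intro a ha
      refine ⟨⟨a, hstar m ha, hop (Nat.le_succ m) ha⟩, rfl, ?_⟩
      rw [zero_add, Submodule.pow_one]
      exact inr_mem_radicalIdeal _
    | succ k ih =>
      intro a ha
      induction ha using AddSubgroup.closure_induction with
      | mem z hz =>
        obtain ⟨_, hx, _, hy, rfl⟩ := hz
        obtain ⟨x, rfl, hxk⟩ := ih _ hx
        obtain ⟨y, rfl, -⟩ := ih _ hy
        refine ⟨x * y, rfl, ?_⟩
        rw [map_mul, Submodule.pow_succ (n := k + 1)]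
        exact Ideal.mul_mem_mul hxk (inr_mem_radicalIdeal y)
      | zero => exact ⟨0, rfl, by simp⟩
      | add _ _ _ _ hx hy =>
        obtain ⟨x, rfl, hx⟩ := hx
        obtain ⟨y, rfl, hy⟩ := hy
        exact ⟨x + y, rfl, by rw [map_add]; exact add_mem hx hy⟩
      | neg _ _ hx =>
        obtain ⟨x, rfl, hx⟩ := hx
        exact ⟨-x, rfl, by rw [map_neg]; exact neg_mem hx⟩
  -- m steps reach O, and one more guarantees being inside S; n further steps land in the power n +
  -- 1 of the ideal, which is zero.
  refine ⟨m + 1 + n, (AddSubgroup.eq_bot_iff_forall _).2 fun a ha => ?_⟩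
  obtain ⟨x, rfl, hx⟩ := key n a ha
  have hle : radicalIdeal A ^ (n + 1) ≤ radicalIdeal A ^ n := by
    rw [Submodule.pow_succ]
    exact Ideal.mul_le_left
  have := hle hx
  rw [hn, Ideal.mem_bot, ← map_zero (inr A)] at this
  rw [inr_injective this, AddSubgroup.coe_zero]

end SkewBrace

theorem mainTheorem8 (A : Type*) [SkewBrace A] [SkewBrace.IsTwoSided A]
    (hmax : WellFoundedGT (AddSubgroup A) ∨ WellFoundedGT (Subgroup A)) :
    (Group.IsSolvable (Multiplicative A) ↔ Group.IsSolvable A) ∧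
      (Group.IsSolvable (Multiplicative A) → SkewBrace.IsSoluble A) := by
  obtain ⟨n, hn⟩ := SkewBrace.exists_radicalIdeal_pow_eq_bot hmax
  refine ⟨⟨fun h => ?_, fun h => ?_⟩, fun h => ?_⟩
  · obtain ⟨h1, h2⟩ := SkewBrace.isSolvable_quotients_of_isSolvable_add h
    exact SkewBrace.isSolvable_mul_of_quotients hn h1 h2
  · obtain ⟨h1, h2⟩ := SkewBrace.isSolvable_quotients_of_isSolvable_mul h
    exact SkewBrace.isSolvable_add_of_quotients h1 h2
  · exact SkewBrace.isSoluble_of_isSolvable_quotient hn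
      (SkewBrace.isSolvable_quotients_of_isSolvable_add h).2
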